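/- **Setting.** A function-oracle Turing machine $M^?$ computes a partial function $f:\mathbb R^k\to\mathbb R$ if for all $\vec x\in\operatorname{dom} f$, all names $\varphi$ of $\vec x$ (rational sequences with $\|\varphi_m-\vec x\|\le 2^{-m}$ for all $m$, maximum norm) and all $p\in\mathbb N$, $M^\varphi(p)$ halts with a rational $y$ such that $|y-f(\vec x)|\le 2^{-p}$. A formula $F=\mathcal L_0\cup\mathcal N$ in separated linear form over variables $x_1,\dots,x_n$ consists of a finite set $\mathcal L_0$ of linear clauses (disjunctions of $q+c_1x_1+\dots+c_nx_n\diamond 0$ with rational coefficients) and a finite set $\mathcal N$ of non-linear constraints $P: f(x_{i_1},\dots,x_{i_k})\diamond 0$ with $\diamond\in\{>,\ge\}$, where $f$ is a partial computable function with a fixed machine $M_f^?$ computing it. Let $B_i\subseteq\mathbb R$ be the set defined by the clauses of $\mathcal L_0$ that are univariate in $x_i$. $F$ is a *bounded instance* if $\prod_i B_i$ is bounded and $\overline{D_P}\subseteq\operatorname{dom} f$ for all $P\in\mathcal N$, where $D_P=\prod_j B_{i_j}$. A *linearisation* of $P$ at a partial rational assignment $\alpha$ with $[\![P]\!]^\alpha=\mathrm{False}$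 is a linear clause $C$ with $[\![C]\!]^\alpha=\mathrm{False}$ such that $[\![P]\!]^\beta=\mathrm{True}$ implies $[\![C]\!]^\beta=\mathrm{True}$ for all $\beta$. It is *$\epsilon$-full* if $[\![C]\!]^\beta=\mathrm{False}$ for all assignments $\beta$ of the variables $\vec x$ of $P$ with $[\![\vec x]\!]^\beta\in B([\![\vec x]\!]^\alpha,\epsilon)$. A run is $\epsilon$-full if all but finitely many of its linearisations are $\epsilon$-full. The non-final states of $\delta$-ksmt are triples $(\alpha,\mathcal L,\mathcal N)$, where $\alpha$ is a sequence of assignments $z\mapsto q\in\mathbb Q$. The transitions are the following. - $(A)$: if $[\![\mathcal L]\!]^\alpha\ne\mathrm{False}$, append $z\mapsto q$ to $\alpha$ for an unassigned $z$ with $[\![\mathcal L]\!]^{\alpha::z\mapsto q}\neq\mathrm{False}$. - $(R)$: if $[\![\mathcal L]\!]^\alpha\ne\mathrm{False}$ and $z$ is unassigned with $[\![\mathcal L]\!]^{\alpha::z\mapsto q}=\mathrm{False}$ for all $q\in\mathbb Q$, add to $\mathcal L$ a finite set of clauses not containing $z$ that are implied by $\mathcal L$, the set evaluating to False under $\alpha$.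 - $(B)$: if $[\![\mathcal L]\!]^\alpha=\mathrm{False}$, replace $\alpha$ by its maximal prefix $\gamma$ with $[\![\mathcal L]\!]^\gamma\ne\mathrm{False}$. - $(L)$: if $[\![\mathcal L]\!]^\alpha\ne\mathrm{False}$, add to $\mathcal L$ a linearisation at $\alpha$ of some $P\in\mathcal N$ with $[\![P]\!]^\alpha=\mathrm{False}$. - Final SAT: if $\alpha$ is total, $[\![\mathcal L]\!]^\alpha=\mathrm{True}$ and none of $(A),(R),(B),(L)$ applies. - Final UNSAT: if $[\![\mathcal L]\!]^{\mathrm{nil}}=\mathrm{False}$. - Final $\delta$-SAT: if $\alpha$ is total and $[\![\mathcal L\wedge\mathcal N_\delta]\!]^\alpha=\mathrm{True}$, where $(f\diamond0)_\delta$ is $f+\delta\diamond 0$. A run is a finite or infinite sequence of transitions. Fix $\delta\in\mathbb Q_{>0}$ and $p\in\mathbb N$ with $p\ge-\lfloor\log_2\min\{1,\delta/4\}\rfloor$, and a rounding operation $\lfloor\cdot\rceil:\mathbb Q^k\to\mathbb Z^k$ (for each $k$) with $\|\lfloor\vec q\rceil-\vec q\|\le\frac12$. For $P:f(\vec x)\diamond0$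 and an assignment $\alpha$ of $\vec x$, the algorithm $\mathrm{LineariseLocal}_\delta$ runs $M_f^\varphi(p+2)$ with $\varphi_m=\lfloor[\![\vec x]\!]^\alpha2^{m+1}\rceil/2^{m+1}$; let $\tilde y$ be its output and $k$ the maximum index it queries ($0$ if none). It returns None if $\tilde y\diamond-\delta/2$, and otherwise the clause $\vec x\notin B([\![\vec x]\!]^\alpha,2^{-k})$. On a state $(\alpha,\mathcal L,\mathcal N)$ with $\alpha$ total and $[\![\mathcal L]\!]^\alpha=\mathrm{True}$, $\mathrm{nlinStepLocal}_\delta$ adds to $\mathcal L$ a clause returned for some $P\in\mathcal N$, or goes to $\delta$-SAT if None is returned for every $P\in\mathcal N$. **Theorem.** Let $\delta\in\mathbb Q_{>0}$. For any bounded instance $\mathcal L_0\cup\mathcal N$ (and any $p$ as above) there is $\epsilon>0$ such that, for every rounding operation: 1. Every $\delta$-ksmt run starting in $(\mathrm{nil},\mathcal L_0,\mathcal N)$ in which the applications of $(L)$ and Final $\delta$-SAT are performed according to $\mathrm{nlinStepLocal}_\delta$ is $\epsilon$-full; indeed, all of its linearisations are $\epsilon$-full. 2. Let the radius $2^{-k}$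 in $\mathrm{LineariseLocal}_\delta$ be replaced by $2^{-(k+1)}$. Then every sequence of steps from $(\mathrm{nil},\mathcal L_0,\mathcal N)$ that applies the rules $(A),(R),(B)$, Final SAT and Final UNSAT of $\delta$-ksmt and, in the place of $(L)$ and Final $\delta$-SAT, $\mathrm{nlinStepLocal}_\delta$ (whose results are not required in advance to be legal transitions) is a $\delta$-ksmt run, and it is $\epsilon$-full, with all of its linearisations $\epsilon$-full. -/

import Mathlib

/-! ## Function-oracle Turing machines and computable real functions -/

/-- Symbols in which numbers are written on the tapes. -/
inductive OSym where
  | zero | one | minus | slash | comma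
  deriving DecidableEq

/-- Binary digits of a natural number (least significant first). -/
def encodeNatSym (m : ℕ) : List OSym :=
  m.bits.map fun b => if b then OSym.one else OSym.zero

/-- The string `[-]numerator/denominator` of a rational number in lowest terms. -/
def encodeRat (q : ℚ) : List OSym :=
  (if q < 0 then [OSym.minus] else []) ++ encodeNatSym q.num.natAbs ++
    OSym.slash :: encodeNatSym q.den

/-- A rational vector is written as the list of its entries, each followed by a comma. -/
def encodeRatVec {k : ℕ} (v : Fin k → ℚ) : List OSym :=
  (List.ofFn v).flatMap fun q => encodeRat q ++ [OSym.comma]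

/-- Tape symbols: blank (`none`), one of the fixed symbols, or one of finitely many extra ones. -/
abbrev TapeSym (g : ℕ) : Type := Option (OSym ⊕ Fin g)

/-- Writes a string of fixed symbols as tape symbols. -/
def toTapeSyms {g : ℕ} (w : List OSym) : List (TapeSym g) :=
  w.map fun a => some (Sum.inl a)

/-- Head movements. -/
inductive HeadMove where
  | left | stay | right

/-- A two-way infinite tape. `left` lists the cells to the left of the head (nearest first) and
`right` the scanned cell and the cells to its right; all cells not listed are blank. -/
structure OTape (g : ℕ) where
  left : List (TapeSym g)
  right : List (TapeSym g)

namespace OTape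

/-- The scanned symbol. -/
def read {g : ℕ} (T : OTape g) : TapeSym g := T.right.headD none

/-- Write a symbol to the scanned cell, then move the head. -/
def writeMove {g : ℕ} (T : OTape g) (a : TapeSym g) : HeadMove → OTape g
  | HeadMove.stay => ⟨T.left, a :: T.right.tail⟩
  | HeadMove.right => ⟨a :: T.left, T.right.tail⟩
  | HeadMove.left => ⟨T.left.tail, T.left.headD none :: a :: T.right.tail⟩

end OTape

/-- A function-oracle Turing machine with a work tape and a query tape, finitely many states and
finitely many tape symbols. The oracle is not part of the machine. -/
structure OracleTM where
  numStates : ℕ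
  numExtra : ℕ
  start : Fin numStates
  query : Fin numStates
  answer : Fin numStates
  halt : Fin numStates
  trans : Fin numStates → TapeSym numExtra → TapeSym numExtra →
    Fin numStates × (TapeSym numExtra × HeadMove) × (TapeSym numExtra × HeadMove)

namespace OracleTM

/-- A configuration, together with the record of all indices queried so far. -/
structure Cfg (M : OracleTM) where
  state : Fin M.numStates
  work : OTape M.numExtra
  qtape : OTape M.numExtra
  queried : List ℕ

/-- The argument `p` is written on the work tape in unary. -/
def init (M : OracleTM) (p : ℕ) : M.Cfg :=
  ⟨M.start, ⟨[], toTapeSyms (List.replicate p OSym.one)⟩, ⟨[], []⟩, []⟩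

/-- The index on the query tape, in unary: the length of the block of ones that starts at the
head. -/
def queryIndex (M : OracleTM) (c : M.Cfg) : ℕ :=
  (c.qtape.right.takeWhile fun a => a == some (Sum.inl OSym.one)).length

/-- One step with oracle `φ`. The halting state is never left. In the query state, the content of
the query tape (an index `m`) is replaced by the string of `φ m`, and the machine passes to the
answer state. -/
def step (M : OracleTM) {k : ℕ} (φ : ℕ → Fin k → ℚ) (c : M.Cfg) : M.Cfg :=
  if c.state = M.halt then c
  else if c.state = M.query then
    ⟨M.answer, c.work, ⟨[], toTapeSyms (encodeRatVec (φ (M.queryIndex c)))⟩,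
      M.queryIndex c :: c.queried⟩
  else
    let r := M.trans c.state c.work.read c.qtape.read
    ⟨r.1, c.work.writeMove r.2.1.1 r.2.1.2, c.qtape.writeMove r.2.2.1 r.2.2.2, c.queried⟩

/-- `M^φ(p)` halts with output `y` (the string on the work tape from the head up to the first
blank), and `k` is the maximum index it queries (`0` if it asks no query). -/
def HaltsWith (M : OracleTM) {n : ℕ} (φ : ℕ → Fin n → ℚ) (p : ℕ) (y : ℚ) (k : ℕ) : Prop :=
  ∃ t : ℕ, ((M.step φ)^[t] (M.init p)).state = M.halt ∧
    ((M.step φ)^[t] (M.init p)).work.right.takeWhile Option.isSome =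
      toTapeSyms (encodeRat y) ∧
    ((M.step φ)^[t] (M.init p)).queried.foldr max 0 = k

end OracleTM

/-- `φ` is a (Cauchy) name of `x ∈ ℝⁿ`; `‖·‖` on `Fin n → ℝ` is the maximum norm. -/
def IsName {n : ℕ} (φ : ℕ → Fin n → ℚ) (x : Fin n → ℝ) : Prop :=
  ∀ m : ℕ, ‖(fun j => ((φ m j : ℚ) : ℝ)) - x‖ ≤ (2 : ℝ)⁻¹ ^ m

/-- `M` computes the partial function `f : ℝⁿ → ℝ`. -/
def OracleTM.Computes (M : OracleTM) {n : ℕ} (f : (Fin n → ℝ) →. ℝ) : Prop :=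
  ∀ (x : Fin n → ℝ) (y : ℝ), y ∈ f x → ∀ φ : ℕ → Fin n → ℚ, IsName φ x →
    ∀ p : ℕ, ∃ (q : ℚ) (k : ℕ), M.HaltsWith φ p q k ∧ |(q : ℝ) - y| ≤ (2 : ℝ)⁻¹ ^ p

/-! ## Formulas in separated linear form over the variables `x_i`, `i : Fin n` -/

/-- Predicate symbols. -/
inductive PredSym where
  | lt | le | gt | ge | eq | ne

/-- Interpretation of `a ⋄ b` over the reals. -/
def PredSym.Holds : PredSym → ℝ → ℝ → Prop
  | PredSym.lt, a, b => a < b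
  | PredSym.le, a, b => a ≤ b
  | PredSym.gt, a, b => a > b
  | PredSym.ge, a, b => a ≥ b
  | PredSym.eq, a, b => a = b
  | PredSym.ne, a, b => a ≠ b

/-- Partial assignments of rationals to the variables. -/
abbrev PAssign (n : ℕ) : Type := Fin n → Option ℚ

/-- The atomic linear constraint `const + ∑ i, coeff i * x_i ⋄ 0`. -/
structure LinAtom (n : ℕ) where
  const : ℚ
  coeff : Fin n → ℚ
  rel : PredSym

namespace LinAtom

/-- Truth of the atom at a real point. -/
def HoldsAt {n : ℕ} (A : LinAtom n) (v : Fin n → ℝ) : Prop :=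
  A.rel.Holds ((A.const : ℝ) + ∑ i, (A.coeff i : ℝ) * v i) 0

/-- All variables of the atom are assigned. -/
def Assigned {n : ℕ} (A : LinAtom n) (α : PAssign n) : Prop :=
  ∀ i, A.coeff i ≠ 0 → α i ≠ none

/-- The atom evaluates to true under the partial assignment. -/
def IsTrue {n : ℕ} (A : LinAtom n) (α : PAssign n) : Prop :=
  A.Assigned α ∧ A.HoldsAt fun i => (((α i).getD 0 : ℚ) : ℝ)

/-- The atom evaluates to false under the partial assignment. -/
def IsFalse {n : ℕ} (A : LinAtom n) (α : PAssign n) : Prop :=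
  A.Assigned α ∧ ¬ A.HoldsAt fun i => (((α i).getD 0 : ℚ) : ℝ)

end LinAtom

/-- A linear clause: a finite disjunction of atomic linear constraints. -/
abbrev LinClause (n : ℕ) : Type := List (LinAtom n)

namespace LinClause

/-- Truth of the clause at a real point. -/
def HoldsAt {n : ℕ} (C : LinClause n) (v : Fin n → ℝ) : Prop := ∃ A ∈ C, A.HoldsAt v

/-- The clause evaluates to true. -/
def IsTrue {n : ℕ} (C : LinClause n) (α : PAssign n) : Prop := ∃ A ∈ C, A.IsTrue α

/-- The clause evaluates to false. -/
def IsFalse {n : ℕ} (C : LinClause n) (α : PAssign n) : Prop := ∀ A ∈ C, A.IsFalse α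

/-- The variables that occur in the clause. -/
def vars {n : ℕ} (C : LinClause n) : Set (Fin n) := {i | ∃ A ∈ C, A.coeff i ≠ 0}

end LinClause

/-- A set of clauses evaluates to true. -/
def ClausesTrue {n : ℕ} (L : Set (LinClause n)) (α : PAssign n) : Prop := ∀ C ∈ L, C.IsTrue α

/-- A set of clauses evaluates to false. -/
def ClausesFalse {n : ℕ} (L : Set (LinClause n)) (α : PAssign n) : Prop := ∃ C ∈ L, C.IsFalse α

/-- A non-linear constraint `f(x_{i_1}, …, x_{i_k}) ⋄ 0` with a partial computable function
`f : ℝᵏ → ℝ`, and the machine that is used to compute `f`. -/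
structure NonlinConstraint (n : ℕ) where
  arity : ℕ
  vars : Fin arity → Fin n
  f : (Fin arity → ℝ) →. ℝ
  machine : OracleTM
  computes : machine.Computes f
  rel : PredSym

namespace NonlinConstraint

/-- The partial assignment `α` assigns the vector `v` to the variables of `P`. -/
def Values {n : ℕ} (P : NonlinConstraint n) (α : PAssign n) (v : Fin P.arity → ℚ) : Prop :=
  ∀ j, α (P.vars j) = some (v j)

/-- `P` evaluates to true. -/
def IsTrue {n : ℕ} (P : NonlinConstraint n) (α : PAssign n) : Prop :=
  ∃ v, P.Values α v ∧ ∃ y ∈ P.f (fun j => (v j : ℝ)), P.rel.Holds y 0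

/-- `P` evaluates to false. -/
def IsFalse {n : ℕ} (P : NonlinConstraint n) (α : PAssign n) : Prop :=
  ∃ v, P.Values α v ∧ ∃ y ∈ P.f (fun j => (v j : ℝ)), ¬ P.rel.Holds y 0

end NonlinConstraint

/-- The `δ`-weakening of `y ⋄ 0`. -/
def PredSym.WeakHolds (δ : ℝ) : PredSym → ℝ → Prop
  | PredSym.lt, y => y - δ < 0
  | PredSym.le, y => y - δ ≤ 0
  | PredSym.gt, y => y + δ > 0
  | PredSym.ge, y => y + δ ≥ 0
  | PredSym.eq, y => |y| - δ ≤ 0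
  | PredSym.ne, y => y - δ < 0 ∨ y + δ > 0

/-- The `δ`-weakening `P_δ` evaluates to true. -/
def NonlinConstraint.WeakTrue {n : ℕ} (P : NonlinConstraint n) (δ : ℚ) (α : PAssign n) : Prop :=
  ∃ v, P.Values α v ∧ ∃ y ∈ P.f (fun j => (v j : ℝ)), P.rel.WeakHolds (δ : ℝ) y

/-- A formula `L₀ ∪ N` in separated linear form. -/
structure SepFormula (n : ℕ) where
  lin : Finset (LinClause n)
  nonlin : Finset (NonlinConstraint n)

namespace SepFormula

/-- The set `B_i` defined by the linear clauses that are univariate in `x_i`. -/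
def varBound {n : ℕ} (F : SepFormula n) (i : Fin n) : Set ℝ :=
  {x | ∀ C ∈ F.lin, C.vars = {i} → C.HoldsAt fun _ => x}

/-- The domain `D_F`, the product of the `B_i`. -/
def domain {n : ℕ} (F : SepFormula n) : Set (Fin n → ℝ) := {v | ∀ i, v i ∈ F.varBound i}

/-- The domain `D_P` of a non-linear constraint. -/
def constraintDomain {n : ℕ} (F : SepFormula n) (P : NonlinConstraint n) :
    Set (Fin P.arity → ℝ) :=
  {v | ∀ j, v j ∈ F.varBound (P.vars j)}

/-- Bounded instances. -/
def IsBoundedInstance {n : ℕ} (F : SepFormula n) : Prop :=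
  Bornology.IsBounded F.domain ∧ ∀ P ∈ F.nonlin, closure (F.constraintDomain P) ⊆ P.f.Dom

end SepFormula

/-! ## Linearisations -/

/-- `C` is a linearisation of `P` at `α`. -/
def IsLinearisation {n : ℕ} (P : NonlinConstraint n) (α : PAssign n) (C : LinClause n) : Prop :=
  P.IsFalse α ∧ (∀ β : PAssign n, P.IsTrue β → C.IsTrue β) ∧ C.IsFalse α

/-- `C` is an `ε`-full linearisation of `P` at `α`. -/
def IsEpsFullLinearisation {n : ℕ} (ε : ℝ) (P : NonlinConstraint n) (α : PAssign n)
    (C : LinClause n) : Prop :=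
  IsLinearisation P α C ∧
    ∀ (a b : Fin P.arity → ℚ) (β : PAssign n), P.Values α a → P.Values β b →
      (fun j => (b j : ℝ)) ∈ Metric.ball (fun j => (a j : ℝ)) ε → C.IsFalse β

/-! ## The `δ`-ksmt calculus -/

/-- The assignment component of a state: the sequence of decisions, the latest one last. -/
abbrev Trail (n : ℕ) : Type := List (Fin n × ℚ)

/-- The partial assignment given by a trail. -/
def Trail.val {n : ℕ} (α : Trail n) : PAssign n := fun z => List.lookup z α

/-- All variables are assigned. -/
def Trail.IsTotal {n : ℕ} (α : Trail n) : Prop := ∀ z, α.val z ≠ none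

/-- States. The non-linear part never changes in a derivation; it is a parameter of the
transition relations. -/
inductive KState (n : ℕ) where
  | active (α : Trail n) (L : Set (LinClause n))
  | sat
  | unsat
  | deltaSat

/-- The rule applied in a transition. -/
inductive RuleLabel (n : ℕ) where
  | assign (z : Fin n) (q : ℚ)
  | resolve (z : Fin n) (R : Finset (LinClause n))
  | backjump
  | linearise (P : NonlinConstraint n) (C : LinClause n)
  | finalSat
  | finalUnsat
  | finalDeltaSat

/-- `R` is a resolvent on `z`: a set of clauses without `z` that are implied by `L`, and that
evaluates to false under `α`. -/
def IsResolvent {n : ℕ} (α : Trail n) (L : Set (LinClause n)) (z : Fin n)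
    (R : Finset (LinClause n)) : Prop :=
  (∀ C ∈ R, z ∉ C.vars ∧ ∀ v : Fin n → ℝ, (∀ C' ∈ L, C'.HoldsAt v) → C.HoldsAt v) ∧
    ClausesFalse (R : Set (LinClause n)) α.val

/-- The rules `(A)`, `(R)`, `(B)`, `(L)` for the non-linear part `N`. -/
inductive CoreStep {n : ℕ} (N : Finset (NonlinConstraint n)) :
    KState n → RuleLabel n → KState n → Prop
  | assign (α : Trail n) (L : Set (LinClause n)) (z : Fin n) (q : ℚ)
      (hL : ¬ ClausesFalse L α.val) (hz : α.val z = none)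
      (hq : ¬ ClausesFalse L (Trail.val (α ++ [(z, q)]))) :
      CoreStep N (KState.active α L) (RuleLabel.assign z q) (KState.active (α ++ [(z, q)]) L)
  | resolve (α : Trail n) (L : Set (LinClause n)) (z : Fin n) (R : Finset (LinClause n))
      (hL : ¬ ClausesFalse L α.val) (hz : α.val z = none)
      (hq : ∀ q : ℚ, ClausesFalse L (Trail.val (α ++ [(z, q)])))
      (hR : IsResolvent α L z R) :
      CoreStep N (KState.active α L) (RuleLabel.resolve z R)
        (KState.active α (L ∪ (R : Set (LinClause n))))
  | backjump (α γ : Trail n) (L : Set (LinClause n))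
      (hL : ClausesFalse L α.val) (hγ : γ <+: α) (hLγ : ¬ ClausesFalse L γ.val)
      (hmax : ∀ γ' : Trail n, γ' <+: α → ¬ ClausesFalse L γ'.val → γ' <+: γ) :
      CoreStep N (KState.active α L) RuleLabel.backjump (KState.active γ L)
  | linearise (α : Trail n) (L : Set (LinClause n)) (P : NonlinConstraint n) (C : LinClause n)
      (hL : ¬ ClausesFalse L α.val) (hP : P ∈ N) (hPα : P.IsFalse α.val)
      (hC : IsLinearisation P α.val C) :
      CoreStep N (KState.active α L) (RuleLabel.linearise P C) (KState.active α (L ∪ {C}))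

/-- The transitions of `δ`-ksmt. -/
inductive DeltaStep {n : ℕ} (N : Finset (NonlinConstraint n)) (δ : ℚ) :
    KState n → RuleLabel n → KState n → Prop
  | core (S S' : KState n) (r : RuleLabel n) (h : CoreStep N S r S') : DeltaStep N δ S r S'
  | finalSat (α : Trail n) (L : Set (LinClause n)) (hα : α.IsTotal) (hL : ClausesTrue L α.val)
      (hno : ∀ r S', ¬ CoreStep N (KState.active α L) r S') :
      DeltaStep N δ (KState.active α L) RuleLabel.finalSat KState.sat
  | finalUnsat (α : Trail n) (L : Set (LinClause n)) (hL : ClausesFalse L (Trail.val [])) :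
      DeltaStep N δ (KState.active α L) RuleLabel.finalUnsat KState.unsat
  | finalDeltaSat (α : Trail n) (L : Set (LinClause n)) (hα : α.IsTotal)
      (hL : ClausesTrue L α.val) (hN : ∀ P ∈ N, P.WeakTrue δ α.val) :
      DeltaStep N δ (KState.active α L) RuleLabel.finalDeltaSat KState.deltaSat

/-! ## Runs -/

/-- A finite (`len < ⊤`) or infinite (`len = ⊤`) labelled sequence of states; only the entries
`state i` with `i ≤ len` and `label i` with `i < len` are meaningful. -/
structure KRun (n : ℕ) where
  len : ℕ∞
  state : ℕ → KState n
  label : ℕ → RuleLabel n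

namespace KRun

/-- The sequence starts in `S₀` and each of its steps is a transition of `T`. -/
def IsRunOf {n : ℕ} (r : KRun n) (T : KState n → RuleLabel n → KState n → Prop)
    (S₀ : KState n) : Prop :=
  r.state 0 = S₀ ∧ ∀ i : ℕ, (i : ℕ∞) < r.len → T (r.state i) (r.label i) (r.state (i + 1))

/-- Step `i` adds `C` to the clauses, as a linearisation of `P` at `α`. -/
def LinearisesAt {n : ℕ} (r : KRun n) (i : ℕ) (P : NonlinConstraint n) (α : Trail n)
    (C : LinClause n) : Prop :=
  (i : ℕ∞) < r.len ∧ r.label i = RuleLabel.linearise P C ∧ ∃ L, r.state i = KState.active α L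

/-- All but finitely many linearisations of the run are `ε`-full. -/
def IsEpsFull {n : ℕ} (r : KRun n) (ε : ℝ) : Prop :=
  {i : ℕ | ∃ P α C, r.LinearisesAt i P α C ∧ ¬ IsEpsFullLinearisation ε P α.val C}.Finite

/-- All linearisations of the run are `ε`-full. -/
def AllEpsFull {n : ℕ} (r : KRun n) (ε : ℝ) : Prop :=
  ∀ i P α C, r.LinearisesAt i P α C → IsEpsFullLinearisation ε P α.val C

end KRun

/-! ## Local linearisation -/

/-- A family of operations that round rational vectors to integer vectors, with error at most
`1/2` in the maximum norm. -/
def IsRounding (rnd : ∀ k : ℕ, (Fin k → ℚ) → (Fin k → ℤ)) : Prop :=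
  ∀ (k : ℕ) (q : Fin k → ℚ) (j : Fin k), |((rnd k q j : ℤ) : ℚ) - q j| ≤ 1 / 2

/-- `Approx(a, m) = round(a * 2^(m+1)) / 2^(m+1)`. -/
def approxDyadic (rnd : ∀ k : ℕ, (Fin k → ℚ) → (Fin k → ℤ)) {k : ℕ} (a : Fin k → ℚ) (m : ℕ) :
    Fin k → ℚ :=
  fun j => ((rnd k (fun i => a i * 2 ^ (m + 1)) j : ℤ) : ℚ) / 2 ^ (m + 1)

/-- The linear clause `x ∉ B(a, r)` on the variables of `P`: some variable `x_{i_j}` satisfies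
`x_{i_j} ≤ a_j - r` or `x_{i_j} ≥ a_j + r`. -/
def outsideBall {n : ℕ} (P : NonlinConstraint n) (a : Fin P.arity → ℚ) (r : ℚ) : LinClause n :=
  (List.finRange P.arity).flatMap fun j =>
    [⟨-(a j - r), Pi.single (P.vars j) 1, PredSym.le⟩,
      ⟨-(a j + r), Pi.single (P.vars j) 1, PredSym.ge⟩]

/-- `LineariseLocal_δ` on `P` and `α`, with precision `p`, returns the given result (`none`, or a
clause). The machine of `P` is run with argument `p + 2` on the approximations of the point
assigned by `α`; `k` is its maximum query. The ball that is cut out has radius `2^(-(k+e))`. -/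
def LineariseLocal {n : ℕ} (rnd : ∀ k : ℕ, (Fin k → ℚ) → (Fin k → ℤ)) (δ : ℚ) (p e : ℕ)
    (P : NonlinConstraint n) (α : PAssign n) (result : Option (LinClause n)) : Prop :=
  ∃ (a : Fin P.arity → ℚ) (y : ℚ) (k : ℕ), P.Values α a ∧
    P.machine.HaltsWith (approxDyadic rnd a) (p + 2) y k ∧
    ((P.rel.Holds (y : ℝ) (-(δ : ℝ) / 2) ∧ result = none) ∨
      (¬ P.rel.Holds (y : ℝ) (-(δ : ℝ) / 2) ∧
        result = some (outsideBall P a ((2 : ℚ)⁻¹ ^ (k + e)))))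

/-- The possible results of `nlinStepLocal_δ` on a state whose assignment is total and satisfies
the linear part: either the clause returned for a constraint `P` of `N` is added, or, if nothing is
returned for any constraint of `N`, the state `δ`-SAT is reached. The constraints may be visited
in any order. -/
inductive NlinStepLocal {n : ℕ} (N : Finset (NonlinConstraint n))
    (rnd : ∀ k : ℕ, (Fin k → ℚ) → (Fin k → ℤ)) (δ : ℚ) (p e : ℕ) :
    KState n → RuleLabel n → KState n → Prop
  | linearise (α : Trail n) (L : Set (LinClause n)) (P : NonlinConstraint n) (C : LinClause n)
      (hα : α.IsTotal) (hL : ClausesTrue L α.val) (hP : P ∈ N)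
      (hC : LineariseLocal rnd δ p e P α.val (some C)) :
      NlinStepLocal N rnd δ p e (KState.active α L) (RuleLabel.linearise P C)
        (KState.active α (L ∪ {C}))
  | finalDeltaSat (α : Trail n) (L : Set (LinClause n)) (hα : α.IsTotal)
      (hL : ClausesTrue L α.val) (hN : ∀ P ∈ N, LineariseLocal rnd δ p e P α.val none) :
      NlinStepLocal N rnd δ p e (KState.active α L) RuleLabel.finalDeltaSat KState.deltaSat

/-- The rules `(L)` and `Final δ-SAT`. -/
def RuleLabel.IsNonlinear {n : ℕ} : RuleLabel n → Prop
  | RuleLabel.linearise _ _ => True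
  | RuleLabel.finalDeltaSat => True
  | _ => False

/-- Transitions of `δ`-ksmt in which `(L)` and `Final δ-SAT` are applied according to
`nlinStepLocal_δ`. -/
def LocalDeltaStep {n : ℕ} (N : Finset (NonlinConstraint n))
    (rnd : ∀ k : ℕ, (Fin k → ℚ) → (Fin k → ℤ)) (δ : ℚ) (p e : ℕ)
    (S : KState n) (r : RuleLabel n) (S' : KState n) : Prop :=
  DeltaStep N δ S r S' ∧ (r.IsNonlinear → NlinStepLocal N rnd δ p e S r S')

/-- The steps of the procedure itself: `nlinStepLocal_δ` in the place of `(L)` and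
`Final δ-SAT`, with no demand that its result be a legal transition of `δ`-ksmt, and the
transitions of `δ`-ksmt by the other rules. -/
def LocalProcStep {n : ℕ} (N : Finset (NonlinConstraint n))
    (rnd : ∀ k : ℕ, (Fin k → ℚ) → (Fin k → ℤ)) (δ : ℚ) (p e : ℕ)
    (S : KState n) (r : RuleLabel n) (S' : KState n) : Prop :=
  (r.IsNonlinear → NlinStepLocal N rnd δ p e S r S') ∧ (¬ r.IsNonlinear → DeltaStep N δ S r S')

/-- The initial state `(nil, L₀, N)`. -/
def SepFormula.initState {n : ℕ} (F : SepFormula n) : KState n :=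
  KState.active [] (F.lin : Set (LinClause n))

/-! ## Strings determine the rational numbers they encode -/

/-! The radius of each local linearisation is governed by the largest query `k`, so fullness reduces
to bounding `k` uniformly. A halting computation sees only a finite part of its oracle
(`HaltsWith.congr`), hence `k` is locally constant on names. The names produced by rounding are
dyadic with integer numerators, and over a compact set of points such names form a compact space
(`isCompact_dyadicNames`); so `k` is bounded there (`OracleTM.Computes.exists_query_bound`). All
clauses of `L₀` persist along a run, so every point at which the machine is called lies in the
bounded domain, whose projection to the variables of a constraint has compact closure inside the
domain of `f`. Finitely many constraints give one bound `B`, and `ε = 2^(-(B+1))` serves both radii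
and every rounding.

Legality with the smaller radius rests on slack in the rounding: the approximations of `a` up to
index `k` begin a name of every rational `b` within `2^(-(k+1))` of `a`, so the output `y` also
approximates `f(b)`. Since the error is below `δ/2`, a value `y` failing the test at `-δ/2` forces
`f < 0` at all assignments in the ball, while passing it gives the `δ`-weakening at `a`
(`LocalProcStep.deltaStep`). -/

theorem encodeNatSym_injective : Function.Injective encodeNatSym := by
  intro a b h
  have hinj : Function.Injective fun b : Bool => if b then OSym.one else OSym.zero := by
    intro x y; cases x <;> cases y <;> simp
  have hb : a.bits = b.bits := hinj.list_map h
  have := congrArg (fun l => List.foldr Nat.bit 0 l) hb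
  have key : ∀ m : ℕ, m.bits.foldr Nat.bit 0 = m := by
    intro m
    induction m using Nat.binaryRec' with
    | zero => simp
    | bit b n hn ih => rw [Nat.bits_append_bit n b hn]; simp [ih]
  simpa [key] using this

theorem minus_notMem_encodeNatSym (m : ℕ) : OSym.minus ∉ encodeNatSym m := by
  simp only [encodeNatSym, List.mem_map, not_exists, not_and]
  intro b _; cases b <;> simp

theorem slash_notMem_encodeNatSym (m : ℕ) : OSym.slash ∉ encodeNatSym m := by
  simp only [encodeNatSym, List.mem_map, not_exists, not_and]
  intro b _; cases b <;> simp

theorem minus_mem_encodeRat (q : ℚ) : OSym.minus ∈ encodeRat q ↔ q < 0 := by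
  have h1 := minus_notMem_encodeNatSym q.num.natAbs
  have h2 := minus_notMem_encodeNatSym q.den
  by_cases hq : q < 0 <;> simp [encodeRat, hq, h1, h2]

/-- The sign is recognised by the presence of `minus`, and the digit strings contain no `slash`, so
the separator splits the string uniquely. This makes the output of a machine well defined as a
number. -/
theorem encodeRat_injective : Function.Injective encodeRat := by
  intro a b h
  have hs : a < 0 ↔ b < 0 := by rw [← minus_mem_encodeRat, h, minus_mem_encodeRat]
  unfold encodeRat at h
  simp only [hs, List.append_assoc] at h
  have h' := List.append_cancel_left h
  rw [List.append_cons_inj_of_notMem (slash_notMem_encodeNatSym _)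
    (slash_notMem_encodeNatSym _)] at h'
  have hn := encodeNatSym_injective h'.1
  have hd := encodeNatSym_injective h'.2.2
  have hnum : a.num = b.num := by
    rw [← Rat.num_neg, ← Rat.num_neg] at hs
    omega
  exact Rat.ext hnum hd

theorem toTapeSyms_injective {g : ℕ} :
    Function.Injective (toTapeSyms : List OSym → List (TapeSym g)) :=
  List.map_injective_iff.2 fun _ _ h => Sum.inl_injective (Option.some_injective _ h)

/-! ## Determinism and the use principle for oracle machines -/

namespace OracleTM

variable (M : OracleTM) {n : ℕ}

theorem step_of_halt {φ : ℕ → Fin n → ℚ} {c : M.Cfg} (h : c.state = M.halt) :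
    M.step φ c = c := by
  simp [step, h]

theorem iterate_eq_of_halt {φ : ℕ → Fin n → ℚ} {c : M.Cfg} {t s : ℕ}
    (h : ((M.step φ)^[t] c).state = M.halt) (hts : t ≤ s) :
    (M.step φ)^[s] c = (M.step φ)^[t] c := by
  obtain ⟨d, rfl⟩ := Nat.exists_eq_add_of_le hts
  rw [add_comm, Function.iterate_add_apply]
  exact Function.iterate_fixed (M.step_of_halt h) d

theorem iterate_eq_of_halt_of_halt {φ : ℕ → Fin n → ℚ} {c : M.Cfg} {t s : ℕ}
    (ht : ((M.step φ)^[t] c).state = M.halt) (hs : ((M.step φ)^[s] c).state = M.halt) :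
    (M.step φ)^[t] c = (M.step φ)^[s] c := by
  rcases le_total t s with h | h
  · exact (M.iterate_eq_of_halt ht h).symm
  · exact M.iterate_eq_of_halt hs h

variable {M}

/-- Halting configurations are fixed points of `step`, so any two halting times show the same
configuration. -/
theorem HaltsWith.unique {φ : ℕ → Fin n → ℚ} {p : ℕ} {y y' : ℚ} {k k' : ℕ}
    (h : M.HaltsWith φ p y k) (h' : M.HaltsWith φ p y' k') : y = y' ∧ k = k' := by
  obtain ⟨t, ht, hy, hk⟩ := h
  obtain ⟨s, hs, hy', hk'⟩ := h'
  rw [M.iterate_eq_of_halt_of_halt ht hs] at hy hk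
  exact ⟨encodeRat_injective (toTapeSyms_injective (hy.symm.trans hy')), hk.symm.trans hk'⟩

theorem queried_subset_step (φ : ℕ → Fin n → ℚ) (c : M.Cfg) :
    c.queried ⊆ (M.step φ c).queried := by
  unfold step
  split_ifs <;> simp

/-- The record after the step already contains the index asked during it, so agreement on that
record suffices. -/
theorem step_congr {φ ψ : ℕ → Fin n → ℚ} {c : M.Cfg}
    (h : ∀ m ∈ (M.step φ c).queried, ψ m = φ m) : M.step ψ c = M.step φ c := by
  unfold step at h ⊢
  split_ifs at h ⊢ with h1 h2
  · rfl
  · rw [h _ List.mem_cons_self]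
  · rfl

theorem iterate_congr {φ ψ : ℕ → Fin n → ℚ} {c : M.Cfg} (t : ℕ)
    (h : ∀ m ∈ ((M.step φ)^[t] c).queried, ψ m = φ m) :
    (M.step ψ)^[t] c = (M.step φ)^[t] c := by
  induction t with
  | zero => rfl
  | succ t ih =>
    rw [Function.iterate_succ_apply'] at h
    rw [Function.iterate_succ_apply', Function.iterate_succ_apply',
      ih fun m hm => h m (queried_subset_step _ _ hm)]
    exact step_congr h

theorem le_foldr_max {l : List ℕ} {m : ℕ} (h : m ∈ l) : m ≤ l.foldr max 0 := by
  induction l with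
  | nil => simp at h
  | cons a l ih =>
    rcases List.mem_cons.1 h with rfl | h
    · exact le_max_left _ _
    · exact (ih h).trans (le_max_right _ _)

/-- A halting computation only depends on the oracle up to the maximum query. -/
theorem HaltsWith.congr {φ ψ : ℕ → Fin n → ℚ} {p : ℕ} {y : ℚ} {k : ℕ}
    (h : M.HaltsWith φ p y k) (hψ : ∀ m ≤ k, ψ m = φ m) : M.HaltsWith ψ p y k := by
  obtain ⟨t, ht, hy, hk⟩ := h
  have := iterate_congr (ψ := ψ) t fun m hm => hψ m (hk ▸ le_foldr_max hm)
  exact ⟨t, by rwa [this], by rwa [this], by rwa [this]⟩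

/-- The output on a name is correct. -/
theorem Computes.abs_sub_le {f : (Fin n → ℝ) →. ℝ} (hM : M.Computes f) {x : Fin n → ℝ} {z : ℝ}
    (hz : z ∈ f x) {φ : ℕ → Fin n → ℚ} (hφ : IsName φ x) {p : ℕ} {y : ℚ} {k : ℕ}
    (h : M.HaltsWith φ p y k) : |(y : ℝ) - z| ≤ (2 : ℝ)⁻¹ ^ p := by
  obtain ⟨q, k', hq, hle⟩ := hM x z hz φ hφ p
  rwa [(h.unique hq).1]

/-- The output on a name is also correct at every rational point that is compatible with the
queried part of the name. -/
theorem Computes.abs_sub_le_of_compatible {f : (Fin n → ℝ) →. ℝ} (hM : M.Computes f)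
    {φ : ℕ → Fin n → ℚ} {p : ℕ} {y : ℚ} {k : ℕ} (h : M.HaltsWith φ p y k) {b : Fin n → ℚ} {z : ℝ}
    (hz : z ∈ f fun j => (b j : ℝ))
    (hb : ∀ m ≤ k, ‖(fun j => ((φ m j : ℚ) : ℝ)) - fun j => (b j : ℝ)‖ ≤ (2 : ℝ)⁻¹ ^ m) :
    |(y : ℝ) - z| ≤ (2 : ℝ)⁻¹ ^ p := by
  -- Splice the queried part of `φ` with the constant sequence `b`: a name of `b` that the
  -- computation cannot distinguish from `φ`.
  refine hM.abs_sub_le hz (φ := fun m => if m ≤ k then φ m else b) (fun m => ?_)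
    (h.congr fun m hm => if_pos hm)
  by_cases hm : m ≤ k
  · simpa only [hm, if_true] using hb m hm
  · simp only [hm, if_false, sub_self, norm_zero]
    positivity

end OracleTM

/-! ## A uniform bound on the queries over a compact set -/

/-- The dyadic sequence with numerators `g`. -/
def dyadicSeq {n : ℕ} (g : ℕ → Fin n → ℤ) (m : ℕ) : Fin n → ℚ :=
  fun j => (g m j : ℚ) / 2 ^ (m + 1)

theorem isCompact_dyadicNames {n : ℕ} {K : Set (Fin n → ℝ)} (hK : IsCompact K) :
    IsCompact {x : (Fin n → ℝ) × (ℕ → Fin n → ℤ) | x.1 ∈ K ∧ IsName (dyadicSeq x.2) x.1} := by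
  obtain ⟨R, hR⟩ := hK.isBounded.exists_norm_le
  -- An entry of a name lies within `2^(-m) ≤ 1` of a point of norm at most `R`, which bounds each
  -- numerator by `(R + 1) * 2^(m+1)`. The ranges are finite, so Tychonoff applies.
  have hT : IsCompact (K ×ˢ (Set.univ.pi fun m : ℕ => Set.univ.pi fun _ : Fin n =>
      Set.Icc (-⌈(R + 1) * 2 ^ (m + 1)⌉) ⌈(R + 1) * 2 ^ (m + 1)⌉)) :=
    hK.prod (isCompact_univ_pi fun m => isCompact_univ_pi fun _ => (Set.finite_Icc _ _).isCompact)
  have hC : IsClosed {x : (Fin n → ℝ) × (ℕ → Fin n → ℤ) | IsName (dyadicSeq x.2) x.1} := by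
    simp only [IsName, Set.ofPred_forall]
    refine isClosed_iInter fun m => isClosed_le ?_ continuous_const
    refine Continuous.norm (Continuous.sub (continuous_pi fun j => ?_) continuous_fst)
    have : Continuous fun z : ℤ => (((z : ℚ) / 2 ^ (m + 1) : ℚ) : ℝ) := continuous_of_discreteTopology
    exact this.comp ((continuous_apply j).comp ((continuous_apply m).comp continuous_snd))
  refine (hT.inter_right hC).of_isClosed_subset ?_ ?_
  · exact (hK.isClosed.preimage continuous_fst).inter hC
  · rintro ⟨x, g⟩ ⟨hx, hg⟩
    refine ⟨⟨hx, fun m _ j _ => ?_⟩, hg⟩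
    have h1 := (norm_le_pi_norm _ j).trans (hg m)
    have h2 := (norm_le_pi_norm x j).trans (hR x hx)
    have h3 : (2 : ℝ)⁻¹ ^ m ≤ 1 := pow_le_one₀ (by norm_num) (by norm_num)
    simp only [dyadicSeq, Pi.sub_apply, Real.norm_eq_abs] at h1 h2
    push_cast at h1
    have h4 : |(g m j : ℝ) / 2 ^ (m + 1)| ≤ R + 1 := by
      have := abs_sub_abs_le_abs_sub ((g m j : ℝ) / 2 ^ (m + 1)) (x j)
      linarith
    rw [abs_div, abs_of_pos (by positivity : (0 : ℝ) < 2 ^ (m + 1)),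
      div_le_iff₀ (by positivity)] at h4
    have h5 : |(g m j : ℝ)| ≤ (⌈(R + 1) * 2 ^ (m + 1)⌉ : ℤ) := h4.trans (Int.le_ceil _)
    have h6 := abs_le.1 (show |g m j| ≤ ⌈(R + 1) * 2 ^ (m + 1)⌉ by exact_mod_cast h5)
    exact ⟨h6.1, h6.2⟩

/-- On the dyadic names of the points of a compact subset of the domain, the machine only asks
boundedly many queries. -/
theorem OracleTM.Computes.exists_query_bound {M : OracleTM} {n : ℕ} {f : (Fin n → ℝ) →. ℝ}
    (hM : M.Computes f) {K : Set (Fin n → ℝ)} (hK : IsCompact K) (hKf : K ⊆ f.Dom) (p : ℕ) :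
    ∃ B : ℕ, ∀ x ∈ K, ∀ g : ℕ → Fin n → ℤ, IsName (dyadicSeq g) x →
      ∀ y k, M.HaltsWith (dyadicSeq g) p y k → k ≤ B := by
  suffices h : ∃ B : ℕ, ∀ x ∈ {x : (Fin n → ℝ) × (ℕ → Fin n → ℤ) | x.1 ∈ K ∧
      IsName (dyadicSeq x.2) x.1}, ∀ y k, M.HaltsWith (dyadicSeq x.2) p y k → k ≤ B by
    obtain ⟨B, hB⟩ := h
    exact ⟨B, fun x hx g hg => hB (x, g) ⟨hx, hg⟩⟩
  -- Having bounded queries passes to subsets and finite unions, so it need only hold near each pair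
  -- of a point and a name.
  refine (isCompact_dyadicNames hK).induction_on (p := fun s => ∃ B : ℕ, ∀ x ∈ s,
    ∀ y k, M.HaltsWith (dyadicSeq x.2) p y k → k ≤ B) ⟨0, by simp⟩ ?_ ?_ ?_
  · rintro s t hst ⟨B, hB⟩
    exact ⟨B, fun x hx => hB x (hst hx)⟩
  · rintro s t ⟨B, hB⟩ ⟨B', hB'⟩
    refine ⟨max B B', ?_⟩
    rintro x (hx | hx) y k h
    · exact (hB x hx y k h).trans (le_max_left _ _)
    · exact (hB' x hx y k h).trans (le_max_right _ _)
  · rintro ⟨x, g⟩ ⟨hx, hg⟩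
    obtain ⟨z, hz⟩ := (PFun.mem_dom _ _).1 (hKf hx)
    obtain ⟨q, k, hq, -⟩ := hM x z hz _ hg p
    -- Numerators are discrete, so agreeing with `g` up to index `k` is an open condition; it fixes
    -- the whole computation.
    have hev : ∀ᶠ u : (Fin n → ℝ) × (ℕ → Fin n → ℤ) in nhds (x, g),
        ∀ m ∈ Set.Iic k, ∀ j, u.2 m j = g m j := by
      refine (Filter.eventually_all_finite (Set.finite_Iic k)).2 fun m _ =>
        Filter.eventually_all.2 fun j => ?_
      have hc : Continuous fun u : (Fin n → ℝ) × (ℕ → Fin n → ℤ) => u.2 m j :=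
        (continuous_apply j).comp ((continuous_apply m).comp continuous_snd)
      exact hc.continuousAt.eventually (mem_nhds_discrete.2 (Set.mem_singleton _))
    refine ⟨_, mem_nhdsWithin_of_mem_nhds hev, k, fun u hu y k' h' => ?_⟩
    have hu' : M.HaltsWith (dyadicSeq u.2) p q k := hq.congr fun m hm => by
      funext j
      simp only [dyadicSeq, hu m hm j]
    exact (h'.unique hu').2.le

/-! ## Dyadic approximation by rounding -/

theorem abs_le_two_inv_pow_iff_cast {x : ℚ} {m : ℕ} :
    |x| ≤ (2 : ℚ)⁻¹ ^ m ↔ |(x : ℝ)| ≤ (2 : ℝ)⁻¹ ^ m := by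
  rw [← Rat.cast_le (K := ℝ)]
  push_cast
  rfl

theorem abs_lt_two_inv_pow_iff_cast {x : ℚ} {m : ℕ} :
    |x| < (2 : ℚ)⁻¹ ^ m ↔ |(x : ℝ)| < (2 : ℝ)⁻¹ ^ m := by
  rw [← Rat.cast_lt (K := ℝ)]
  push_cast
  rfl

section Rounding

variable {rnd : ∀ k : ℕ, (Fin k → ℚ) → (Fin k → ℤ)} {n : ℕ}

theorem approxDyadic_eq_dyadicSeq (a : Fin n → ℚ) :
    approxDyadic rnd a = dyadicSeq fun m => rnd n fun i => a i * 2 ^ (m + 1) := rfl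

/-- Half a unit at scale `2^(m+1)` is four times sharper than a name requires; the slack is what
makes room for neighbouring points. -/
theorem norm_approxDyadic_sub_le (hrnd : IsRounding rnd) (a : Fin n → ℚ) (m : ℕ) :
    ‖(fun j => ((approxDyadic rnd a m j : ℚ) : ℝ)) - fun j => (a j : ℝ)‖ ≤
      (2 : ℝ)⁻¹ ^ (m + 2) := by
  refine (pi_norm_le_iff_of_nonneg (by positivity)).2 fun j => ?_
  have h := hrnd n (fun i => a i * 2 ^ (m + 1)) j
  have h2 : |approxDyadic rnd a m j - a j| ≤ (2 : ℚ)⁻¹ ^ (m + 2) := by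
    have he : approxDyadic rnd a m j - a j =
        (((rnd n (fun i => a i * 2 ^ (m + 1)) j : ℤ) : ℚ) - a j * 2 ^ (m + 1)) / 2 ^ (m + 1) := by
      rw [sub_div, mul_div_cancel_right₀ _ (by positivity)]
      rfl
    rw [he, abs_div, abs_of_pos (by positivity : (0 : ℚ) < 2 ^ (m + 1)),
      div_le_iff₀ (by positivity)]
    refine h.trans (le_of_eq ?_)
    rw [pow_succ (2 : ℚ)⁻¹, inv_pow]
    field_simp
  rw [Pi.sub_apply, Real.norm_eq_abs]
  exact_mod_cast abs_le_two_inv_pow_iff_cast.1 h2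

theorem isName_approxDyadic (hrnd : IsRounding rnd) (a : Fin n → ℚ) :
    IsName (approxDyadic rnd a) fun j => (a j : ℝ) := fun m =>
  (norm_approxDyadic_sub_le hrnd a m).trans
    (pow_le_pow_of_le_one (by norm_num) (by norm_num) (by omega))

/-- The approximations of `a` up to index `k` are the beginning of a name of every point in the
ball of radius `2 ^ (-(k + 1))` around `a`. -/
theorem norm_approxDyadic_sub_le_of_close (hrnd : IsRounding rnd) {a b : Fin n → ℚ} {k m : ℕ}
    (hab : ∀ j, |b j - a j| < (2 : ℚ)⁻¹ ^ (k + 1)) (hm : m ≤ k) :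
    ‖(fun j => ((approxDyadic rnd a m j : ℚ) : ℝ)) - fun j => (b j : ℝ)‖ ≤ (2 : ℝ)⁻¹ ^ m := by
  have h1 := norm_approxDyadic_sub_le hrnd a m
  have h2 : ‖(fun j => (a j : ℝ)) - fun j => (b j : ℝ)‖ ≤ (2 : ℝ)⁻¹ ^ (m + 1) := by
    refine (pi_norm_le_iff_of_nonneg (by positivity)).2 fun j => ?_
    have h3 := (hab j).le.trans (pow_le_pow_of_le_one (by norm_num) (by norm_num)
      (by omega : m + 1 ≤ k + 1))
    rw [abs_sub_comm] at h3
    rw [Pi.sub_apply, Real.norm_eq_abs]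
    exact_mod_cast abs_le_two_inv_pow_iff_cast.1 h3
  -- The two errors add up to three quarters of `2^(-m)`. With radius `2^(-k)` this estimate would
  -- fail at `m = k`.
  refine (norm_sub_le_norm_sub_add_norm_sub _ (fun j => (a j : ℝ)) _).trans
    ((add_le_add h1 h2).trans ?_)
  have : (0 : ℝ) < (2 : ℝ)⁻¹ ^ m := by positivity
  rw [pow_add, pow_succ (2 : ℝ)⁻¹ m]
  linarith

end Rounding

/-! ## The clause `x ∉ B(a, r)` -/

section OutsideBall

variable {n : ℕ} {P : NonlinConstraint n} {α : PAssign n} {a b : Fin P.arity → ℚ}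

theorem LinAtom.assigned_single {i : Fin n} {c v : ℚ} {s : PredSym} (h : α i = some v) :
    (LinAtom.mk c (Pi.single i 1) s).Assigned α := by
  intro i' hi'
  obtain rfl : i' = i := by
    by_contra hne
    exact hi' (by simp [hne])
  simp [h]

theorem LinAtom.holdsAt_single {i : Fin n} {c v : ℚ} {s : PredSym} (h : α i = some v) :
    ((LinAtom.mk c (Pi.single i 1) s).HoldsAt fun i => (((α i).getD 0 : ℚ) : ℝ)) ↔
      s.Holds ((c : ℝ) + v) 0 := by
  have : ∑ x, (((Pi.single i 1 : Fin n → ℚ) x : ℚ) : ℝ) * (((α x).getD 0 : ℚ) : ℝ) = v := by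
    rw [Finset.sum_eq_single i]
    · simp [h]
    · intro x _ hx
      simp [hx]
    · simp
  simp [LinAtom.HoldsAt, this]

theorem outsideBall_isFalse_iff {r : ℚ} (hb : P.Values α b) :
    (outsideBall P a r).IsFalse α ↔ ∀ j, |b j - a j| < r := by
  simp only [outsideBall, LinClause.IsFalse, List.mem_flatMap, List.mem_finRange, true_and,
    forall_exists_index, List.mem_cons, List.not_mem_nil, or_false]
  rw [forall_comm]
  refine forall_congr' fun j => ?_
  simp only [forall_eq_or_imp, forall_eq, LinAtom.IsFalse, LinAtom.assigned_single (hb j),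
    true_and, LinAtom.holdsAt_single (hb j), PredSym.Holds, ge_iff_le, not_le]
  rw [abs_lt]
  norm_cast
  constructor <;> rintro ⟨h1, h2⟩ <;> constructor <;> linarith

/-- Every atom of the clause is assigned once the variables of `P` are, so truth and falsity are
complementary here. -/
theorem outsideBall_isTrue_iff {r : ℚ} (hb : P.Values α b) :
    (outsideBall P a r).IsTrue α ↔ ¬ ∀ j, |b j - a j| < r := by
  rw [← outsideBall_isFalse_iff hb]
  simp only [LinClause.IsTrue, LinClause.IsFalse, not_forall, exists_prop]
  refine exists_congr fun A => and_congr_right fun hA => ?_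
  simp only [outsideBall, List.mem_flatMap, List.mem_finRange, true_and, List.mem_cons,
    List.not_mem_nil, or_false] at hA
  have hA' : A.Assigned α := by
    obtain ⟨j, rfl | rfl⟩ := hA <;> exact LinAtom.assigned_single (hb j)
  simp [LinAtom.IsTrue, LinAtom.IsFalse, hA']

end OutsideBall

/-! ## Correctness of local linearisation -/

theorem NonlinConstraint.Values.unique {n : ℕ} {P : NonlinConstraint n} {α : PAssign n}
    {a b : Fin P.arity → ℚ} (ha : P.Values α a) (hb : P.Values α b) : a = b :=
  funext fun j => Option.some_injective _ ((ha j).symm.trans (hb j))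

theorem two_inv_pow_le_of_neg_floor_logb_le {x : ℝ} (hx : 0 < x) {p : ℕ}
    (hp : -⌊Real.logb 2 x⌋ ≤ (p : ℤ)) : (2 : ℝ)⁻¹ ^ p ≤ x := by
  have h1 : (-(p : ℤ)) ≤ ⌊Real.logb 2 x⌋ := by omega
  have h2 := Int.le_floor.1 h1
  rw [Real.le_logb_iff_rpow_le (by norm_num) hx, Real.rpow_intCast, zpow_neg, zpow_natCast,
    ← inv_pow] at h2
  exact h2

/-- The choice of `p` gives `2^(-p) ≤ δ/4`, so precision `p + 2` has error at most `δ/16`. -/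
theorem two_inv_pow_add_two_lt {δ : ℝ} (hδ : 0 < δ) {p : ℕ}
    (hp : -⌊Real.logb 2 (min 1 (δ / 4))⌋ ≤ (p : ℤ)) : (2 : ℝ)⁻¹ ^ (p + 2) < δ / 2 := by
  have h := (two_inv_pow_le_of_neg_floor_logb_le (lt_min one_pos (by positivity)) hp).trans
    (min_le_right _ _)
  rw [pow_add]
  linarith

section Local

variable {n : ℕ} {P : NonlinConstraint n} {α : PAssign n} {a : Fin P.arity → ℚ}
  {rnd : ∀ k : ℕ, (Fin k → ℚ) → (Fin k → ℤ)} {δ : ℚ} {p : ℕ}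

theorem LineariseLocal.isLinearisation {C : LinClause n} (hrnd : IsRounding rnd)
    (hrel : P.rel = PredSym.gt ∨ P.rel = PredSym.ge) (hp : (2 : ℝ)⁻¹ ^ (p + 2) < (δ : ℝ) / 2)
    (ha : P.Values α a) (hdom : (fun j => (a j : ℝ)) ∈ P.f.Dom)
    (h : LineariseLocal rnd δ p 1 P α (some C)) : IsLinearisation P α C := by
  obtain ⟨a', y, k, ha', hM, ⟨-, hC⟩ | ⟨hy, hC⟩⟩ := h
  · cases hC
  obtain rfl := ha.unique ha'
  obtain rfl := Option.some_injective _ hC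
  -- The failed test gives `y ≤ -δ/2`, so such a `z` is negative. This is used both at `a` and at
  -- any `b` in the excluded ball.
  have hneg : ∀ z : ℝ, |(y : ℝ) - z| ≤ (2 : ℝ)⁻¹ ^ (p + 2) → ¬ P.rel.Holds z 0 := by
    intro z hz
    have := abs_le.1 hz
    rcases hrel with hr | hr <;> simp only [hr, PredSym.Holds] at hy ⊢ <;> linarith
  refine ⟨?_, ?_, (outsideBall_isFalse_iff ha).2 fun j => ?_⟩
  · obtain ⟨z, hz⟩ := (PFun.mem_dom _ _).1 hdom
    exact ⟨a, ha, z, hz, hneg z (P.computes.abs_sub_le hz (isName_approxDyadic hrnd a) hM)⟩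
  · rintro β ⟨b, hb, z, hz, hzP⟩
    rw [outsideBall_isTrue_iff hb]
    intro hab
    exact hneg z (P.computes.abs_sub_le_of_compatible hM hz fun m hm =>
      norm_approxDyadic_sub_le_of_close hrnd hab hm) hzP
  · rw [sub_self, abs_zero]
    positivity

theorem LineariseLocal.weakTrue {e : ℕ} (hrnd : IsRounding rnd)
    (hrel : P.rel = PredSym.gt ∨ P.rel = PredSym.ge) (hp : (2 : ℝ)⁻¹ ^ (p + 2) < (δ : ℝ) / 2)
    (ha : P.Values α a) (hdom : (fun j => (a j : ℝ)) ∈ P.f.Dom)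
    (h : LineariseLocal rnd δ p e P α none) : P.WeakTrue δ α := by
  obtain ⟨a', y, k, ha', hM, ⟨hy, -⟩ | ⟨-, hC⟩⟩ := h
  swap
  · cases hC
  obtain rfl := ha.unique ha'
  obtain ⟨z, hz⟩ := (PFun.mem_dom _ _).1 hdom
  refine ⟨a, ha, z, hz, ?_⟩
  have := abs_le.1 (P.computes.abs_sub_le hz (isName_approxDyadic hrnd a) hM)
  rcases hrel with hr | hr <;> simp only [hr, PredSym.Holds, PredSym.WeakHolds] at hy ⊢ <;>
    linarith

/-- Since `k + e ≤ B + 1`, the excluded ball contains the one of radius `2^(-(B+1))`. Legality is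
assumed, so the lemma covers both radii. -/
theorem LineariseLocal.isEpsFullLinearisation {e B : ℕ} {C : LinClause n} (he : e ≤ 1)
    (hB : ∀ y k, P.machine.HaltsWith (approxDyadic rnd a) (p + 2) y k → k ≤ B)
    (ha : P.Values α a) (h : LineariseLocal rnd δ p e P α (some C))
    (hlin : IsLinearisation P α C) :
    IsEpsFullLinearisation ((2 : ℝ)⁻¹ ^ (B + 1)) P α C := by
  refine ⟨hlin, fun a' b β ha' hb hab => ?_⟩
  obtain rfl := ha.unique ha'
  obtain ⟨a', y, k, ha', hM, ⟨-, hC⟩ | ⟨-, hC⟩⟩ := h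
  · cases hC
  obtain rfl := ha.unique ha'
  obtain rfl := Option.some_injective _ hC
  refine (outsideBall_isFalse_iff hb).2 fun j => ?_
  have h1 := (dist_le_pi_dist _ _ j).trans_lt (Metric.mem_ball.1 hab)
  rw [Real.dist_eq] at h1
  have h2 : |b j - a j| < (2 : ℚ)⁻¹ ^ (B + 1) :=
    abs_lt_two_inv_pow_iff_cast.2 (by exact_mod_cast h1)
  have hk := hB y k hM
  exact h2.trans_le (pow_le_pow_of_le_one (by norm_num) (by norm_num) (by omega))

end Local

/-! ## The assignments at which nonlinear steps are made -/

theorem LinClause.IsTrue.not_isFalse {n : ℕ} {C : LinClause n} {α : PAssign n}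
    (h : C.IsTrue α) : ¬ C.IsFalse α := by
  obtain ⟨A, hA, hT⟩ := h
  exact fun hF => (hF A hA).2 hT.2

theorem ClausesTrue.not_clausesFalse {n : ℕ} {L : Set (LinClause n)} {α : PAssign n}
    (h : ClausesTrue L α) : ¬ ClausesFalse L α := fun ⟨C, hC, hF⟩ => (h C hC).not_isFalse hF

theorem SepFormula.mem_domain_of_clausesTrue {n : ℕ} {F : SepFormula n} {α : PAssign n}
    (h : ClausesTrue (F.lin : Set (LinClause n)) α) :
    (fun i => (((α i).getD 0 : ℚ) : ℝ)) ∈ F.domain := by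
  intro i C hC hvars
  obtain ⟨A, hA, -, hT⟩ := h C hC
  refine ⟨A, hA, ?_⟩
  unfold LinAtom.HoldsAt at hT ⊢
  -- Only `x_i` can have a nonzero coefficient. If it is unassigned, the true atom `A` has no
  -- variables, so the default value 0 is harmless.
  suffices hs : ∑ j, (A.coeff j : ℝ) * (((α i).getD 0 : ℚ) : ℝ) =
      ∑ j, (A.coeff j : ℝ) * (((α j).getD 0 : ℚ) : ℝ) by rwa [hs]
  refine Finset.sum_congr rfl fun j _ => ?_
  by_cases hj : A.coeff j = 0
  · simp [hj]
  · have : j ∈ C.vars := ⟨A, hA, hj⟩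
    rw [hvars, Set.mem_singleton_iff] at this
    rw [this]

/-- The vector of values of the variables of `P`, where unassigned variables count as zero. -/
def NonlinConstraint.valueVec {n : ℕ} (P : NonlinConstraint n) (α : PAssign n) :
    Fin P.arity → ℚ :=
  fun j => (α (P.vars j)).getD 0

theorem Trail.IsTotal.values_valueVec {n : ℕ} {α : Trail n} (hα : α.IsTotal)
    (P : NonlinConstraint n) : P.Values α.val (P.valueVec α.val) := by
  intro j
  obtain ⟨q, hq⟩ := Option.ne_none_iff_exists'.1 (hα (P.vars j))
  simp [NonlinConstraint.valueVec, hq]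

namespace SepFormula

variable {n : ℕ} {F : SepFormula n}

theorem valueVec_mem_constraintDomain {α : PAssign n} (P : NonlinConstraint n)
    (h : ClausesTrue (F.lin : Set (LinClause n)) α) :
    (fun j => (P.valueVec α j : ℝ)) ∈ F.constraintDomain P :=
  fun j => mem_domain_of_clausesTrue h (P.vars j)

theorem IsBoundedInstance.valueVec_mem_dom (hF : F.IsBoundedInstance) {α : PAssign n}
    {P : NonlinConstraint n} (hP : P ∈ F.nonlin)
    (h : ClausesTrue (F.lin : Set (LinClause n)) α) :
    (fun j => (P.valueVec α j : ℝ)) ∈ P.f.Dom :=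
  hF.2 P hP (subset_closure (valueVec_mem_constraintDomain P h))

theorem IsBoundedInstance.exists_query_bound_of_mem (hF : F.IsBoundedInstance) (p : ℕ)
    {P : NonlinConstraint n} (hP : P ∈ F.nonlin) :
    ∃ B : ℕ, ∀ rnd : ∀ k : ℕ, (Fin k → ℚ) → (Fin k → ℤ), IsRounding rnd →
      ∀ α : PAssign n, ClausesTrue (F.lin : Set (LinClause n)) α →
      ∀ y k, P.machine.HaltsWith (approxDyadic rnd (P.valueVec α)) p y k → k ≤ B := by
  -- The projection of `F.domain` replaces `constraintDomain P`: the latter may be unbounded when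
  -- some `B_i` of another variable is empty.
  let K : Set (Fin P.arity → ℝ) := closure ((fun v j => v (P.vars j)) '' F.domain)
  have hK : IsCompact K := by
    refine Bornology.IsBounded.isCompact_closure ?_
    obtain ⟨R, hR⟩ := hF.1.exists_norm_le
    refine (Metric.isBounded_closedBall (x := 0) (r := max R 0)).subset ?_
    rintro _ ⟨v, hv, rfl⟩
    rw [mem_closedBall_zero_iff]
    exact (pi_norm_le_iff_of_nonneg (le_max_right _ _)).2 fun j =>
      (norm_le_pi_norm v (P.vars j)).trans ((hR v hv).trans (le_max_left _ _))
  have hKf : K ⊆ P.f.Dom := by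
    refine (closure_mono ?_).trans (hF.2 P hP)
    rintro _ ⟨v, hv, rfl⟩ j
    exact hv (P.vars j)
  obtain ⟨B, hB⟩ := P.computes.exists_query_bound hK hKf p
  refine ⟨B, fun rnd hrnd α hα y k h => hB _ (subset_closure
    ⟨_, mem_domain_of_clausesTrue hα, rfl⟩) _ ?_ y k (approxDyadic_eq_dyadicSeq _ ▸ h)⟩
  exact isName_approxDyadic hrnd (P.valueVec α)

theorem IsBoundedInstance.exists_query_bound (hF : F.IsBoundedInstance) (p : ℕ) :
    ∃ B : ℕ, ∀ P ∈ F.nonlin, ∀ rnd : ∀ k : ℕ, (Fin k → ℚ) → (Fin k → ℤ), IsRounding rnd →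
      ∀ α : PAssign n, ClausesTrue (F.lin : Set (LinClause n)) α →
      ∀ y k, P.machine.HaltsWith (approxDyadic rnd (P.valueVec α)) p y k → k ≤ B := by
  choose B hB using fun P : F.nonlin => hF.exists_query_bound_of_mem p P.2
  refine ⟨Finset.univ.sup B, fun P hP rnd hrnd α hα y k h => ?_⟩
  exact (hB ⟨P, hP⟩ rnd hrnd α hα y k h).trans (Finset.le_sup (Finset.mem_univ _))

end SepFormula

/-! ## Runs -/

/-- Every clause of `L₀` is present in a state that is not final. -/
def KState.Contains {n : ℕ} (L₀ : Set (LinClause n)) : KState n → Prop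
  | KState.active _ L => L₀ ⊆ L
  | _ => True

theorem DeltaStep.contains {n : ℕ} {N : Finset (NonlinConstraint n)} {δ : ℚ}
    {L₀ : Set (LinClause n)} {S S' : KState n} {l : RuleLabel n} (h : DeltaStep N δ S l S')
    (hS : S.Contains L₀) : S'.Contains L₀ := by
  rcases h with ⟨_, _, _, h⟩ | _ | _ | _
  · cases h with
    | assign => exact hS
    | resolve => exact hS.trans Set.subset_union_left
    | backjump => exact hS
    | linearise => exact hS.trans Set.subset_union_left
  all_goals trivial

/-- Legality of procedure steps is known only at states that contain `L₀`, so `hT` asks for it only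
there, and the invariant is carried along in the same induction. -/
theorem KRun.IsRunOf.contains {n : ℕ} {r : KRun n} {N : Finset (NonlinConstraint n)} {δ : ℚ}
    {L₀ : Set (LinClause n)} {T : KState n → RuleLabel n → KState n → Prop} {S₀ : KState n}
    (hr : r.IsRunOf T S₀) (hS₀ : S₀.Contains L₀)
    (hT : ∀ S l S', S.Contains L₀ → T S l S' → DeltaStep N δ S l S') (i : ℕ)
    (hi : (i : ℕ∞) ≤ r.len) : (r.state i).Contains L₀ := by
  induction i with
  | zero => rwa [hr.1]
  | succ i ih =>
    have hi' : (i : ℕ∞) < r.len := lt_of_lt_of_le (by exact_mod_cast i.lt_succ_self) hi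
    have hc := ih hi'.le
    exact (hT _ _ _ hc (hr.2 i hi')).contains hc

theorem KRun.AllEpsFull.isEpsFull {n : ℕ} {r : KRun n} {ε : ℝ} (h : r.AllEpsFull ε) :
    r.IsEpsFull ε := by
  have : {i : ℕ | ∃ P α C, r.LinearisesAt i P α C ∧
      ¬ IsEpsFullLinearisation ε P α.val C} = ∅ :=
    Set.eq_empty_of_forall_notMem fun i ⟨P, α, C, hl, hn⟩ => hn (h i P α C hl)
  rw [KRun.IsEpsFull, this]
  exact Set.finite_empty

section Procedure

variable {n : ℕ} {F : SepFormula n} {rnd : ∀ k : ℕ, (Fin k → ℚ) → (Fin k → ℤ)} {δ : ℚ} {p : ℕ}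

/-- With the smaller radius, the steps of the procedure are legal. -/
theorem LocalProcStep.deltaStep (hF : F.IsBoundedInstance)
    (hrel : ∀ P ∈ F.nonlin, P.rel = PredSym.gt ∨ P.rel = PredSym.ge)
    (hp : (2 : ℝ)⁻¹ ^ (p + 2) < (δ : ℝ) / 2) (hrnd : IsRounding rnd) {S S' : KState n}
    {l : RuleLabel n} (hS : S.Contains (F.lin : Set (LinClause n)))
    (h : LocalProcStep F.nonlin rnd δ p 1 S l S') : DeltaStep F.nonlin δ S l S' := by
  by_cases hl : l.IsNonlinear
  swap
  · exact h.2 hl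
  cases h.1 hl with
  | linearise α L P C hα hL hP hC =>
    have hL₀ : ClausesTrue (F.lin : Set (LinClause n)) α.val := fun C hC => hL C (hS hC)
    have hlin := hC.isLinearisation hrnd (hrel P hP) hp (hα.values_valueVec P)
      (hF.valueVec_mem_dom hP hL₀)
    exact .core _ _ _ (.linearise α L P C hL.not_clausesFalse hP hlin.1 hlin)
  | finalDeltaSat α L hα hL hN =>
    have hL₀ : ClausesTrue (F.lin : Set (LinClause n)) α.val := fun C hC => hL C (hS hC)
    exact .finalDeltaSat α L hα hL fun P hP => (hN P hP).weakTrue hrnd (hrel P hP) hp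
      (hα.values_valueVec P) (hF.valueVec_mem_dom hP hL₀)

theorem KRun.IsRunOf.allEpsFull {r : KRun n} {e B : ℕ} (he : e ≤ 1)
    (hB : ∀ P ∈ F.nonlin, ∀ α : PAssign n, ClausesTrue (F.lin : Set (LinClause n)) α →
      ∀ y k, P.machine.HaltsWith (approxDyadic rnd (P.valueVec α)) (p + 2) y k → k ≤ B)
    (hr : r.IsRunOf (LocalDeltaStep F.nonlin rnd δ p e) F.initState) :
    r.AllEpsFull ((2 : ℝ)⁻¹ ^ (B + 1)) := by
  rintro i P α C ⟨hi, hl, L, hS⟩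
  have hc : (r.state i).Contains (F.lin : Set (LinClause n)) :=
    hr.contains (Set.Subset.refl _) (fun _ _ _ _ h => h.1) i hi.le
  obtain ⟨hd, hn⟩ := hr.2 i hi
  rw [hl, hS] at hd hn
  rw [hS] at hc
  generalize r.state (i + 1) = S' at hd hn
  obtain ⟨_, _, _, hd⟩ := hd
  obtain ⟨⟩ | ⟨⟩ | ⟨⟩ | ⟨_, _, _, _, -, -, -, hlin⟩ := hd
  cases hn trivial with
  | linearise _ _ _ _ hα hL hP hC =>
    have hL₀ : ClausesTrue (F.lin : Set (LinClause n)) α.val := fun C hC => hL C (hc hC)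
    exact hC.isEpsFullLinearisation he (hB P hP α.val hL₀) (hα.values_valueVec P) hlin

end Procedure

theorem mainTheorem4 {n : ℕ} (F : SepFormula n) (hF : F.IsBoundedInstance)
    (hrel : ∀ P ∈ F.nonlin, P.rel = PredSym.gt ∨ P.rel = PredSym.ge)
    (δ : ℚ) (hδ : 0 < δ) (p : ℕ) (hp : -⌊Real.logb 2 (min 1 ((δ : ℝ) / 4))⌋ ≤ (p : ℤ)) :
    ∃ ε : ℝ, 0 < ε ∧
      ∀ rnd : ∀ k : ℕ, (Fin k → ℚ) → (Fin k → ℤ), IsRounding rnd →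
        (∀ r : KRun n, r.IsRunOf (LocalDeltaStep F.nonlin rnd δ p 0) F.initState →
          r.IsEpsFull ε ∧ r.AllEpsFull ε) ∧
        (∀ r : KRun n, r.IsRunOf (LocalProcStep F.nonlin rnd δ p 1) F.initState →
          r.IsRunOf (DeltaStep F.nonlin δ) F.initState ∧ r.IsEpsFull ε ∧ r.AllEpsFull ε) := by
  -- The machines are run with argument `p + 2`; the bound is independent of the rounding, so `ε`
  -- can be fixed before it.
  obtain ⟨B, hB⟩ := hF.exists_query_bound (p + 2)
  have hp' := two_inv_pow_add_two_lt (Rat.cast_pos.2 hδ) hp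
  refine ⟨(2 : ℝ)⁻¹ ^ (B + 1), by positivity, fun rnd hrnd => ⟨fun r hr => ?_, fun r hr => ?_⟩⟩
  · have := hr.allEpsFull zero_le_one fun P hP => hB P hP rnd hrnd
    exact ⟨this.isEpsFull, this⟩
  · have hlegal : ∀ S l S', S.Contains (F.lin : Set (LinClause n)) →
        LocalProcStep F.nonlin rnd δ p 1 S l S' → DeltaStep F.nonlin δ S l S' :=
      fun _ _ _ hS h => h.deltaStep hF hrel hp' hrnd hS
    have hstep : ∀ i : ℕ, (i : ℕ∞) < r.len →
        DeltaStep F.nonlin δ (r.state i) (r.label i) (r.state (i + 1)) := fun i hi =>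
      hlegal _ _ _ (hr.contains (Set.Subset.refl _) hlegal i hi.le) (hr.2 i hi)
    -- Once legality is known, the procedure's run is a local run with `e = 1`, and fullness follows
    -- as for the larger radius.
    have hr' : r.IsRunOf (LocalDeltaStep F.nonlin rnd δ p 1) F.initState :=
      ⟨hr.1, fun i hi => ⟨hstep i hi, (hr.2 i hi).1⟩⟩
    have := hr'.allEpsFull le_rfl fun P hP => hB P hP rnd hrnd
    exact ⟨⟨hr.1, hstep⟩, this.isEpsFull, this⟩
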